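/- Let $n$ be a positive integer and let $f\colon\{0,1\}^n\to\{0,1\}$ be a Boolean function. A real polynomial in $X_1,\dots,X_n$ is called multilinear if no variable occurs in it with exponent larger than $1$; $\deg$ of a polynomial is its total degree (the zero polynomial is given degree $0$). Define the following. - $\deg(f)$ is the degree of the unique multilinear $p\in\mathbb{R}[X_1,\dots,X_n]$ with $p(x)=f(x)$ for all $x\in\{0,1\}^n$. - $\mathrm{rdeg}(f)$, the rational degree, is the minimum of $\max(\deg(p),\deg(q))$ over all pairs of multilinear $p,q\in\mathbb{R}[X_1,\dots,X_n]$ such that $q(x)\neq 0$ and $p(x)/q(x)=f(x)$ for all $x\in\{0,1\}^n$. - $\mathrm{sdeg}(f)$, the sign degree, is the minimum of $\deg(p)$ over all multilinear $p\in\mathbb{R}[X_1,\dots,X_n]$ such that, for all $x\in\{0,1\}^n$, $p(x)\neq 0$, and $p(x)<0$ if and only if $f(x)=1$. - $D(f)$, the decision tree complexity, is the minimum depth of a deterministic decision tree that queries single bits of $x$ and outputs $f(x)$ at the leaf reached, for every $x\in\{0,1\}^n$. Then $$\deg(f)\;\le\; D(f)\;\le\; 4\,\mathrm{sdeg}(f)^2\,\mathrm{rdeg}(f)^2\;\le\;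 16\,\mathrm{rdeg}(f)^4 .$$ -/

import Mathlib

namespace BooleanFunction

open MvPolynomial

/-- A Boolean function `{0,1}^n → {0,1}`. -/
abbrev BoolFn (n : ℕ) : Type := (Fin n → Bool) → Bool

/-- The real number `0` or `1` named by a bit. -/
def bit (b : Bool) : ℝ := if b then 1 else 0

/-- The value `p(x)` of a real polynomial at a point `x` of the cube `{0,1}^n`. -/
noncomputable def cubeEval {n : ℕ} (p : MvPolynomial (Fin n) ℝ) (x : Fin n → Bool) : ℝ :=
  MvPolynomial.eval (fun i => bit (x i)) p

/-- A polynomial is multilinear if no variable occurs in it with exponent larger than one. -/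
def IsMultilinear {n : ℕ} (p : MvPolynomial (Fin n) ℝ) : Prop :=
  ∀ i, p.degreeOf i ≤ 1

theorem exists_multilinear {n : ℕ} (g : (Fin n → Bool) → ℝ) :
    ∃ p : MvPolynomial (Fin n) ℝ, IsMultilinear p ∧ ∀ x, cubeEval p x = g x := by
  classical
  refine ⟨∑ a : Fin n → Bool, C (g a) * ∏ j, (if a j then X j else 1 - X j), ?_, ?_⟩
  · intro i
    refine (degreeOf_sum_le i _ _).trans (Finset.sup_le fun a _ => ?_)
    refine (degreeOf_C_mul_le _ i _).trans ((degreeOf_prod_le i _ _).trans ?_)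
    have key : ∀ j, degreeOf i (if a j then X j else 1 - X j : MvPolynomial (Fin n) ℝ)
        ≤ if i = j then 1 else 0 := by
      intro j
      have hX : degreeOf i (X j : MvPolynomial (Fin n) ℝ) = if i = j then 1 else 0 :=
        degreeOf_X i j
      split_ifs with h1 h2 h2
      · simp [h2]
      · simp [hX, h2]
      · refine (degreeOf_sub_le i _ _).trans ?_
        simp [h2]
      · refine (degreeOf_sub_le i _ _).trans ?_
        simp [hX, h2]
    calc _ ≤ ∑ j, (if i = j then 1 else 0) := Finset.sum_le_sum fun j _ => key j
      _ = 1 := by simp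
      _ ≤ 1 := le_rfl
  · intro x
    have hprod : ∀ a : Fin n → Bool,
        (∏ j, (if a j then bit (x j) else 1 - bit (x j))) = if a = x then 1 else 0 := by
      intro a
      split_ifs with h
      · subst h
        refine Finset.prod_eq_one fun j _ => ?_
        cases h : a j <;> simp [bit]
      · obtain ⟨j, hj⟩ := Function.ne_iff.mp h
        refine Finset.prod_eq_zero (Finset.mem_univ j) ?_
        cases h1 : a j <;> cases h2 : x j <;> simp_all [bit]
    simp only [cubeEval, map_sum, map_mul, eval_C, map_prod, apply_ite (eval _), eval_X, map_sub,
      map_one]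
    simp [hprod]
theorem multilinear_ext {n : ℕ} {p q : MvPolynomial (Fin n) ℝ} (hp : IsMultilinear p)
    (hq : IsMultilinear q) (h : ∀ x, cubeEval p x = cubeEval q x) : p = q := by
  classical
  refine sub_eq_zero.mp (eq_zero_of_eval_zero_at_prod_finset (p - q)
    (fun _ => ({0, 1} : Finset ℝ)) (fun i => ?_) (fun y hy => ?_))
  · have h2 : ({0, 1} : Finset ℝ).card = 2 := by simp
    have := (degreeOf_sub_le i p q).trans (max_le (hp i) (hq i))
    omega
  · have hxy : (fun i => bit (decide (y i = 1))) = y := by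
      funext i
      have := hy i
      simp only [Finset.mem_insert, Finset.mem_singleton] at this
      rcases this with h0 | h1 <;> simp [bit, *]
    have := h (fun i => decide (y i = 1))
    simp only [cubeEval, hxy] at this
    simp [this]

/-- Every real function on the cube agrees on the cube with exactly one multilinear polynomial. -/
theorem existsUnique_multilinear {n : ℕ} (g : (Fin n → Bool) → ℝ) :
    ∃! p : MvPolynomial (Fin n) ℝ, IsMultilinear p ∧ ∀ x, cubeEval p x = g x := by
  obtain ⟨p, hp, hpe⟩ := exists_multilinear g
  exact ⟨p, ⟨hp, hpe⟩, fun q hq => multilinear_ext hq.1 hp fun x => by rw [hq.2, hpe]⟩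

/-- The unique multilinear polynomial that agrees with `g` on the cube. -/
noncomputable def multilinearRep {n : ℕ} (g : (Fin n → Bool) → ℝ) : MvPolynomial (Fin n) ℝ :=
  (existsUnique_multilinear g).choose

theorem multilinearRep_spec {n : ℕ} (g : (Fin n → Bool) → ℝ) :
    IsMultilinear (multilinearRep g) ∧ ∀ x, cubeEval (multilinearRep g) x = g x :=
  (existsUnique_multilinear g).choose_spec.1

/-- The degree of a Boolean function: the degree of its unique multilinear representation. -/
noncomputable def deg {n : ℕ} (f : BoolFn n) : ℕ :=
  (multilinearRep fun x => bit (f x)).totalDegree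

/-- `p / q` is a rational representation of `f`. -/
def IsRationalRep {n : ℕ} (f : BoolFn n) (p q : MvPolynomial (Fin n) ℝ) : Prop :=
  IsMultilinear p ∧ IsMultilinear q ∧
    ∀ x, cubeEval q x ≠ 0 ∧ cubeEval p x / cubeEval q x = bit (f x)

/-- The rational degree of `f`: the minimum of `max (deg p) (deg q)` over all rational
representations `p / q` of `f`. -/
noncomputable def rdeg {n : ℕ} (f : BoolFn n) : ℕ :=
  sInf {d | ∃ p q, IsRationalRep f p q ∧ d = max p.totalDegree q.totalDegree}

/-- `p` is a sign representation of `f`. -/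
def IsSignRep {n : ℕ} (f : BoolFn n) (p : MvPolynomial (Fin n) ℝ) : Prop :=
  IsMultilinear p ∧ ∀ x, cubeEval p x ≠ 0 ∧ (cubeEval p x < 0 ↔ f x = true)

/-- The sign degree of `f`: the minimum degree of a sign representation of `f`. -/
noncomputable def sdeg {n : ℕ} (f : BoolFn n) : ℕ :=
  sInf {d | ∃ p, IsSignRep f p ∧ d = p.totalDegree}

/-- Deterministic decision trees that query single bits of an `n`-bit input. -/
inductive DecisionTree (n : ℕ) : Type
  /-- Stop and output `b`. -/
  | leaf (b : Bool) : DecisionTree n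
  /-- Query bit `i`; continue with `t₀` if it is `0` and with `t₁` if it is `1`. -/
  | query (i : Fin n) (t₀ t₁ : DecisionTree n) : DecisionTree n

/-- The output of a decision tree on the input `x`. -/
def DecisionTree.eval {n : ℕ} : DecisionTree n → (Fin n → Bool) → Bool
  | .leaf b, _ => b
  | .query i t₀ t₁, x => if x i then t₁.eval x else t₀.eval x

/-- The depth of a decision tree: the largest number of queries on a path from root to leaf. -/
def DecisionTree.depth {n : ℕ} : DecisionTree n → ℕ
  | .leaf _ => 0
  | .query _ t₀ t₁ => 1 + max t₀.depth t₁.depth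

/-- The decision tree `t` computes `f` exactly on every input. -/
def DecisionTree.Computes {n : ℕ} (t : DecisionTree n) (f : BoolFn n) : Prop :=
  ∀ x, t.eval x = f x

/-- The decision tree complexity of `f`: the minimum depth of a decision tree that computes `f`. -/
noncomputable def D {n : ℕ} (f : BoolFn n) : ℕ :=
  sInf {d | ∃ t : DecisionTree n, t.Computes f ∧ d = t.depth}

/-! The minima above are over nonempty sets, so they are attained. -/

theorem rdeg_attained {n : ℕ} (f : BoolFn n) :
    ∃ p q, IsRationalRep f p q ∧ rdeg f = max p.totalDegree q.totalDegree := by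
  refine Nat.sInf_mem (s := {d | ∃ p q, IsRationalRep f p q ∧ d = _}) ?_
  obtain ⟨p, hp, hpe⟩ := exists_multilinear fun x => bit (f x)
  refine ⟨_, p, 1, ⟨hp, fun i => ?_, fun x => ?_⟩, rfl⟩
  · simp
  · simp [← hpe, cubeEval]

theorem sdeg_attained {n : ℕ} (f : BoolFn n) : ∃ p, IsSignRep f p ∧ sdeg f = p.totalDegree := by
  refine Nat.sInf_mem (s := {d | ∃ p, IsSignRep f p ∧ d = _}) ?_
  obtain ⟨p, hp, hpe⟩ := exists_multilinear fun x => if f x then (-1 : ℝ) else 1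
  refine ⟨_, p, ⟨hp, fun x => ?_⟩, rfl⟩
  rw [hpe]
  cases f x <;> norm_num

theorem exists_computes {n : ℕ} (f : BoolFn n) : ∃ t : DecisionTree n, t.Computes f := by
  suffices H : ∀ (s : Finset (Fin n)) (g : BoolFn n),
      (∀ x y, (∀ i ∈ s, x i = y i) → g x = g y) → ∃ t : DecisionTree n, t.Computes g from
    H Finset.univ f fun x y h => congrArg f (funext fun i => h i (Finset.mem_univ i))
  intro s
  induction s using Finset.induction_on with
  | empty =>
    intro g hg
    exact ⟨.leaf (g fun _ => false), fun x => hg _ _ (by simp)⟩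
  | insert i s _ ih =>
    intro g hg
    have key : ∀ b, ∃ t : DecisionTree n, t.Computes fun x => g (Function.update x i b) := by
      refine fun b => ih _ fun x y h => hg _ _ fun j _ => ?_
      by_cases hji : j = i
      · subst hji; simp
      · have : j ∈ s := by simp_all
        simp [Function.update_of_ne hji, h j this]
    obtain ⟨t₀, h₀⟩ := key false
    obtain ⟨t₁, h₁⟩ := key true
    refine ⟨.query i t₀ t₁, fun x => ?_⟩
    cases hx : x i
    · simp only [DecisionTree.eval, hx, h₀ x]
      simp [← hx]
    · simp only [DecisionTree.eval, hx, h₁ x]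
      simp [← hx]

theorem D_attained {n : ℕ} (f : BoolFn n) :
    ∃ t : DecisionTree n, t.Computes f ∧ D f = t.depth := by
  refine Nat.sInf_mem (s := {d | ∃ t : DecisionTree n, t.Computes f ∧ d = _}) ?_
  obtain ⟨t, ht⟩ := exists_computes f
  exact ⟨_, t, ht, rfl⟩

end BooleanFunction

/-!
If `f = p / q` on the cube, then `p` is nonzero exactly where `f = 1` and `q - p` exactly where
`f = 0`. Let `s` be a sign representation of degree `d`, let `|s|` be maximal at `x`, and let `g`
be whichever of `p` and `q - p` vanishes at `x`. With the other variables fixed as in `x`, `g` is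
not identically zero in the variables of any of its top-degree monomials, so flipping some of these
variables at `x` changes the sign of `s`. Markov's inequality allows at most `2 * d ^ 2` disjoint
blocks of variables with this property. The variables of a maximal family of disjoint top-degree
monomials of `g` are therefore at most `2 * d ^ 2 * deg g` in number, and querying them lowers the
degree of `g`, since they meet every top-degree monomial. Repeating this until `p` or `q - p` is
constant costs at most `2 * d ^ 2 * (deg p ^ 2 + deg (q - p) ^ 2)` queries.
-/

namespace BooleanFunction

section CubeDegreeLE

open Finset

variable {ι κ : Type*} {d e : ℕ} {S : Finset ι} {g h : (ι → Bool) → ℝ}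

/-- The multilinear monomial `∏ i ∈ S, Xᵢ`, as a function on the cube. -/
def cubeMonomial (S : Finset ι) (x : ι → Bool) : ℝ := ∏ i ∈ S, bit (x i)

/-- The real functions on the cube that are given by polynomials of degree at most `d`. Functions
rather than polynomials are used because they have the relations `Xᵢ ^ 2 = Xᵢ` built in; the index
type is arbitrary so that variables of one cube can be substituted into another. -/
def cubeDegreeLE (ι : Type*) (d : ℕ) : Submodule ℝ ((ι → Bool) → ℝ) :=
  Submodule.span ℝ (cubeMonomial '' {S : Finset ι | #S ≤ d})

theorem cubeMonomial_eq_ite (S : Finset ι) (x : ι → Bool) :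
    cubeMonomial S x = if ∀ i ∈ S, x i = true then 1 else 0 := by
  simp [cubeMonomial, bit, prod_ite_zero]

theorem cubeMonomial_mul_cubeMonomial [DecidableEq ι] (S T : Finset ι) :
    cubeMonomial S * cubeMonomial T = cubeMonomial (S ∪ T) := by
  funext x
  simp only [Pi.mul_apply, cubeMonomial_eq_ite, forall_mem_union, ite_and, mul_ite, mul_one,
    mul_zero]
  split_ifs <;> rfl

theorem cubeMonomial_piecewise [DecidableEq ι] (S U : Finset ι) (x y : ι → Bool) :
    cubeMonomial S (U.piecewise y x) = cubeMonomial (S ∩ U) y * cubeMonomial (S \ U) x := by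
  simp only [cubeMonomial, ← prod_piecewise]
  exact prod_congr rfl fun i _ => apply_ite bit (i ∈ U) (y i) (x i)

theorem cubeMonomial_mem_cubeDegreeLE (hS : #S ≤ d) : cubeMonomial S ∈ cubeDegreeLE ι d :=
  Submodule.subset_span ⟨S, hS, rfl⟩

theorem cubeDegreeLE_mono (h : d ≤ e) : cubeDegreeLE ι d ≤ cubeDegreeLE ι e :=
  Submodule.span_mono (Set.image_mono fun _ hS => le_trans hS h)

theorem const_mem_cubeDegreeLE (r : ℝ) (d : ℕ) : (fun _ => r) ∈ cubeDegreeLE ι d := by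
  have h_smul : (fun _ => r) = r • cubeMonomial (∅ : Finset ι) := by
    funext x
    simp [cubeMonomial]
  rw [h_smul]
  exact Submodule.smul_mem _ _ (cubeMonomial_mem_cubeDegreeLE (by simp))

theorem apply_mem_cubeDegreeLE (φ : Bool → ℝ) (i : ι) :
    (fun x => φ (x i)) ∈ cubeDegreeLE ι 1 := by
  have h_affine : (fun x : ι → Bool => φ (x i)) =
      (fun _ => φ false) + (φ true - φ false) • cubeMonomial {i} := by
    funext x
    cases hx : x i <;> simp [cubeMonomial, bit, hx]
  rw [h_affine]
  exact Submodule.add_mem _ (const_mem_cubeDegreeLE _ _)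
    (Submodule.smul_mem _ _ (cubeMonomial_mem_cubeDegreeLE (by simp)))

theorem mul_mem_cubeDegreeLE (hg : g ∈ cubeDegreeLE ι d) (hh : h ∈ cubeDegreeLE ι e) :
    g * h ∈ cubeDegreeLE ι (d + e) := by
  classical
  suffices h_le : cubeDegreeLE ι d * cubeDegreeLE ι e ≤ cubeDegreeLE ι (d + e) from
    h_le (Submodule.mul_mem_mul hg hh)
  rw [cubeDegreeLE, cubeDegreeLE, Submodule.span_mul_span, Submodule.span_le]
  rintro _ ⟨_, ⟨S, hS, rfl⟩, _, ⟨T, hT, rfl⟩, rfl⟩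
  beta_reduce
  rw [cubeMonomial_mul_cubeMonomial]
  exact cubeMonomial_mem_cubeDegreeLE ((card_union_le S T).trans (add_le_add hS hT))

theorem prod_mem_cubeDegreeLE {T : Finset κ} {G : κ → (ι → Bool) → ℝ} {δ : κ → ℕ}
    (hG : ∀ k ∈ T, G k ∈ cubeDegreeLE ι (δ k)) :
    ∏ k ∈ T, G k ∈ cubeDegreeLE ι (∑ k ∈ T, δ k) := by
  classical
  induction T using Finset.induction_on with
  | empty => exact const_mem_cubeDegreeLE 1 0
  | insert k T hk ih =>
    rw [prod_insert hk, sum_insert hk]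
    exact mul_mem_cubeDegreeLE (hG k (mem_insert_self k T))
      (ih fun j hj => hG j (mem_insert_of_mem hj))

theorem comp_mem_cubeDegreeLE (hg : g ∈ cubeDegreeLE ι d) {σ : (κ → Bool) → ι → Bool}
    (hσ : ∀ i, (fun w => bit (σ w i)) ∈ cubeDegreeLE κ 1) : g ∘ σ ∈ cubeDegreeLE κ d := by
  suffices h_le : cubeDegreeLE ι d ≤ (cubeDegreeLE κ d).comap (LinearMap.funLeft ℝ ℝ σ) from
    h_le hg
  rw [cubeDegreeLE, Submodule.span_le]
  rintro _ ⟨S, hS, rfl⟩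
  have h_prod : LinearMap.funLeft ℝ ℝ σ (cubeMonomial S) = ∏ i ∈ S, fun w => bit (σ w i) := by
    funext w
    simp [LinearMap.funLeft_apply, cubeMonomial]
  rw [SetLike.mem_coe, Submodule.mem_comap, h_prod]
  exact cubeDegreeLE_mono (by simpa using hS) (prod_mem_cubeDegreeLE fun i _ => hσ i)

theorem comp_piecewise_mem_cubeDegreeLE [DecidableEq ι] (hg : g ∈ cubeDegreeLE ι d)
    (U : Finset ι) (y : ι → Bool) : (fun x => g (U.piecewise y x)) ∈ cubeDegreeLE ι d := by
  refine comp_mem_cubeDegreeLE (σ := fun x => U.piecewise y x) hg fun i => ?_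
  by_cases hi : i ∈ U
  · simpa [hi] using const_mem_cubeDegreeLE _ _
  · simpa [hi] using apply_mem_cubeDegreeLE bit i

theorem apply_eq_apply_of_mem_cubeDegreeLE_zero (hg : g ∈ cubeDegreeLE ι 0) (x y : ι → Bool) :
    g x = g y := by
  suffices h_le : cubeDegreeLE ι 0 ≤
      LinearMap.eqLocus (LinearMap.proj x : _ →ₗ[ℝ] ℝ) (LinearMap.proj y) from h_le hg
  rw [cubeDegreeLE, Submodule.span_le]
  rintro _ ⟨S, hS, rfl⟩
  obtain rfl : S = ∅ := by simpa using hS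
  simp [cubeMonomial]

theorem exists_coeff_of_mem_cubeDegreeLE (hg : g ∈ cubeDegreeLE ι d) :
    ∃ c : Finset ι →₀ ℝ, (∀ S ∈ c.support, #S ≤ d) ∧
      g = Finsupp.linearCombination ℝ cubeMonomial c := by
  obtain ⟨c, hc, rfl⟩ := (Finsupp.mem_span_image_iff_linearCombination ℝ).mp hg
  exact ⟨c, fun S hS => hc hS, rfl⟩

end CubeDegreeLE

section TopMonomials

open Finset

variable {ι : Type*} [DecidableEq ι] {d : ℕ} {c : Finset ι →₀ ℝ}

theorem comp_piecewise_mem_cubeDegreeLE_of_not_disjoint (hc : ∀ S ∈ c.support, #S ≤ d + 1)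
    {U : Finset ι} (hU : ∀ S ∈ c.support, #S = d + 1 → ¬ Disjoint S U) (y : ι → Bool) :
    (fun x => Finsupp.linearCombination ℝ cubeMonomial c (U.piecewise y x)) ∈
      cubeDegreeLE ι d := by
  have h_expand : (fun x => Finsupp.linearCombination ℝ cubeMonomial c (U.piecewise y x)) =
      ∑ S ∈ c.support, (c S * cubeMonomial (S ∩ U) y) • cubeMonomial (S \ U) := by
    funext x
    simp [Finsupp.linearCombination_apply, Finsupp.sum, cubeMonomial_piecewise, mul_assoc]
  rw [h_expand]
  refine Submodule.sum_mem _ fun S hS =>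
    Submodule.smul_mem _ _ (cubeMonomial_mem_cubeDegreeLE (Nat.lt_succ_iff.mp ?_))
  rcases (hc S hS).lt_or_eq with h_lt | h_top
  · exact (card_le_card sdiff_subset).trans_lt h_lt
  · rw [Nat.succ_eq_add_one, ← h_top]
    refine card_lt_card (sdiff_subset.ssubset_of_ne fun h_eq => hU S hS h_top ?_)
    exact sdiff_eq_self_iff_disjoint.mp h_eq

theorem sum_powerset_neg_one_pow_mul_cubeMonomial_self (S : Finset ι) (x : ι → Bool) :
    ∑ B ∈ S.powerset, (-1) ^ #B * cubeMonomial S (B.piecewise xᶜ x) =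
      ∏ i ∈ S, (bit (x i) - bit (!x i)) := by
  rw [prod_sub]
  refine sum_congr rfl fun B hB => ?_
  rw [cubeMonomial_piecewise, inter_eq_right.mpr (mem_powerset.mp hB), mul_assoc]
  simp [cubeMonomial, mul_comm]

theorem sum_powerset_neg_one_pow_mul_cubeMonomial_eq_zero {S M : Finset ι} (h : ¬ M ⊆ S)
    (x : ι → Bool) :
    ∑ B ∈ M.powerset, (-1) ^ #B * cubeMonomial S (B.piecewise xᶜ x) = 0 := by
  obtain ⟨i, hiM, hiS⟩ := not_subset.mp h
  rw [← insert_erase hiM, sum_powerset_insert (notMem_erase i M), ← sum_add_distrib]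
  refine sum_eq_zero fun B hB => ?_
  have hiB : i ∉ B := fun hi => notMem_erase i M (mem_powerset.mp hB hi)
  rw [card_insert_of_notMem hiB, cubeMonomial_piecewise, cubeMonomial_piecewise,
    inter_insert_of_notMem hiS, sdiff_insert_of_notMem hiS]
  ring

theorem exists_flip_ne_zero_of_top_mem_support {M : Finset ι} (hM : M ∈ c.support)
    (hc : ∀ S ∈ c.support, #S ≤ #M) (x : ι → Bool) :
    ∃ B ⊆ M, Finsupp.linearCombination ℝ cubeMonomial c (B.piecewise xᶜ x) ≠ 0 := by
  by_contra! h_vanish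
  have h_alternating : c M * ∏ i ∈ M, (bit (x i) - bit (!x i)) = 0 := calc
    _ = ∑ S ∈ c.support,
          c S * ∑ B ∈ M.powerset, (-1) ^ #B * cubeMonomial S (B.piecewise xᶜ x) := by
        rw [sum_eq_single_of_mem M hM fun S hS hSM => ?_,
          sum_powerset_neg_one_pow_mul_cubeMonomial_self]
        rw [sum_powerset_neg_one_pow_mul_cubeMonomial_eq_zero, mul_zero]
        exact fun hMS => hSM (eq_of_subset_of_card_le hMS (hc S hS)).symm
    _ = ∑ B ∈ M.powerset,
          (-1) ^ #B * Finsupp.linearCombination ℝ cubeMonomial c (B.piecewise xᶜ x) := by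
        simp only [Finsupp.linearCombination_apply, Finsupp.sum, Finset.sum_apply, Pi.smul_apply,
          smul_eq_mul, mul_sum]
        rw [sum_comm]
        simp only [mul_left_comm]
    _ = 0 := sum_eq_zero fun B hB => by rw [h_vanish B (mem_powerset.mp hB), mul_zero]
  refine (mul_ne_zero (Finsupp.mem_support_iff.mp hM) (prod_ne_zero_iff.mpr fun i _ => ?_))
    h_alternating
  cases x i <;> norm_num [bit]

end TopMonomials

section Markov

open Polynomial

/-- Markov's inequality at the left endpoint: among the polynomials bounded by `1` on `[-1, 1]`,
the Chebyshev polynomial has the largest derivative at `1`, and that derivative is `d ^ 2`. -/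
theorem neg_le_eval_derivative_left {d : ℕ} {P : ℝ[X]} {a b M : ℝ} (hab : a < b) (hM : 0 < M)
    (hd : P.natDegree ≤ d) (hP : ∀ t ∈ Set.Icc a b, |P.eval t| ≤ M) :
    -(2 * d ^ 2 * M / (b - a)) ≤ (derivative P).eval a := by
  let Q : ℝ[X] := C M⁻¹ * P.comp (C ((a + b) / 2) - C ((b - a) / 2) * X)
  have hQ_degree : Q.degree ≤ d := by
    refine natDegree_le_iff_degree_le.mp ((natDegree_C_mul_le _ _).trans ?_)
    have h_affine : (C ((a + b) / 2) - C ((b - a) / 2) * X).natDegree ≤ 1 := by compute_degree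
    exact natDegree_comp_le.trans ((Nat.mul_le_mul hd h_affine).trans_eq (mul_one d))
  have hQ_bound : ∀ t ∈ Set.Icc (-1 : ℝ) 1, |Q.eval t| ≤ 1 := by
    intro t ht
    have h_mem : (a + b) / 2 - (b - a) / 2 * t ∈ Set.Icc a b :=
      ⟨by nlinarith [ht.2], by nlinarith [ht.1]⟩
    simpa [Q, abs_mul, abs_of_pos hM, inv_mul_le_iff₀ hM] using hP _ h_mem
  have h_chebyshev : (derivative Q).eval 1 ≤ (d : ℝ) ^ 2 := by
    simpa [Chebyshev.T_derivative_eq_U, Chebyshev.U_eval_one, pow_two] using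
      Chebyshev.eval_iterate_derivative_le_of_forall_abs_le_one (k := 1) le_rfl hQ_degree hQ_bound
  have h_chain : (derivative Q).eval 1 = -(M⁻¹ * ((b - a) / 2) * (derivative P).eval a) := by
    have h_left : (a + b) / 2 - (b - a) / 2 = a := by ring
    simp only [Q, derivative_mul, derivative_C, zero_mul, derivative_comp, derivative_sub,
      derivative_X, mul_one, zero_add, zero_sub, eval_neg, eval_mul, eval_C,
      eval_comp, eval_sub, eval_X, h_left]
    ring
  have hba : 0 < b - a := sub_pos.mpr hab
  rw [neg_le, le_div_iff₀ hba]
  calc -(derivative P).eval a * (b - a) = (derivative Q).eval 1 * (2 * M) := by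
        rw [h_chain]
        field_simp
    _ ≤ (d : ℝ) ^ 2 * (2 * M) := by gcongr
    _ = 2 * d ^ 2 * M := by ring

end Markov

section BernoulliMean

open Finset Polynomial

variable {κ : Type*} [Fintype κ] [DecidableEq κ] {d : ℕ} {g : (κ → Bool) → ℝ}

/-- The mean of `g` when the coordinates are independent and each is true with probability `X`, as
a polynomial in `X`. This is a univariate shadow of `g` of no larger degree, to which Markov's
inequality applies. -/
noncomputable def bernoulliMean : ((κ → Bool) → ℝ) →ₗ[ℝ] ℝ[X] :=
  ∑ w : κ → Bool, (LinearMap.proj w).smulRight (∏ k, if w k then X else 1 - X)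

theorem bernoulliMean_apply (g : (κ → Bool) → ℝ) :
    bernoulliMean g = ∑ w : κ → Bool, g w • ∏ k, if w k then X else 1 - X := by
  simp [bernoulliMean]

theorem bernoulliMean_cubeMonomial (S : Finset κ) :
    bernoulliMean (cubeMonomial S) = (X : ℝ[X]) ^ #S := by
  have h_factor (w : κ → Bool) :
      (cubeMonomial S w • ∏ k, if w k then X else 1 - X : ℝ[X]) =
        ∏ k, (if k ∈ S then C (bit (w k)) else 1) * if w k then X else 1 - X := by
    rw [prod_mul_distrib, prod_ite_mem, univ_inter, cubeMonomial, smul_eq_C_mul, map_prod]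
  simp only [bernoulliMean_apply, h_factor]
  rw [← Fintype.prod_sum fun k (b : Bool) =>
    (if k ∈ S then C (bit b) else 1) * (if b then X else 1 - X : ℝ[X])]
  calc ∏ k, ∑ b : Bool, (if k ∈ S then C (bit b) else 1) * (if b then X else 1 - X : ℝ[X])
      = ∏ k, if k ∈ S then X else 1 := by
        refine prod_congr rfl fun k _ => ?_
        split_ifs <;> simp [bit]
    _ = X ^ #S := by rw [prod_ite_mem, univ_inter, prod_const]

theorem natDegree_bernoulliMean_le (hg : g ∈ cubeDegreeLE κ d) :
    (bernoulliMean g).natDegree ≤ d := by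
  suffices h_le : cubeDegreeLE κ d ≤ (degreeLE ℝ d).comap bernoulliMean from
    natDegree_le_iff_degree_le.mpr (mem_degreeLE.mp (h_le hg))
  rw [cubeDegreeLE, Submodule.span_le]
  rintro _ ⟨S, hS, rfl⟩
  rw [SetLike.mem_coe, Submodule.mem_comap, bernoulliMean_cubeMonomial, mem_degreeLE]
  exact (degree_X_pow_le _).trans (by exact_mod_cast hS)

theorem abs_eval_bernoulliMean_le {M t : ℝ} (hg : ∀ w, |g w| ≤ M) (ht : t ∈ Set.Icc (0 : ℝ) 1) :
    |(bernoulliMean g).eval t| ≤ M := by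
  let weight (w : κ → Bool) : ℝ := ∏ k, if w k then t else 1 - t
  have h_nonneg (w : κ → Bool) : 0 ≤ weight w :=
    prod_nonneg fun k _ => by split_ifs <;> linarith [ht.1, ht.2]
  have h_eval (h : (κ → Bool) → ℝ) : (bernoulliMean h).eval t = ∑ w, h w * weight w := by
    simp [bernoulliMean_apply, eval_finsetSum, eval_prod, apply_ite (eval t), weight]
  have h_sum : ∑ w, weight w = 1 := by
    simpa [cubeMonomial, bernoulliMean_cubeMonomial] using (h_eval (cubeMonomial ∅)).symm
  calc |(bernoulliMean g).eval t| ≤ ∑ w, |g w * weight w| :=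
        h_eval g ▸ abs_sum_le_sum_abs _ _
    _ ≤ ∑ w, M * weight w := sum_le_sum fun w _ => by
        rw [abs_mul, abs_of_nonneg (h_nonneg w)]
        exact mul_le_mul_of_nonneg_right (hg w) (h_nonneg w)
    _ = M := by rw [← mul_sum, h_sum, mul_one]

theorem cubeMonomial_update_bot_sub_cubeMonomial_bot {κ : Type*} [DecidableEq κ] (S : Finset κ)
    (k : κ) :
    cubeMonomial S (Function.update ⊥ k true) - cubeMonomial S ⊥ = if S = {k} then 1 else 0 := by
  have h_update : (∀ i ∈ S, Function.update (⊥ : κ → Bool) k true i = true) ↔ S ⊆ {k} := by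
    simp [Function.update_apply, subset_iff]
  have h_bot : (∀ i ∈ S, (⊥ : κ → Bool) i = true) ↔ S = ∅ := by
    simp [eq_empty_iff_forall_notMem]
  simp only [cubeMonomial_eq_ite, h_update, h_bot, subset_singleton_iff]
  rcases eq_or_ne S ∅ with rfl | hS
  · simp
  · simp [hS]

theorem eval_zero_derivative_bernoulliMean (hg : g ∈ cubeDegreeLE κ d) :
    (derivative (bernoulliMean g)).eval 0 = ∑ k, (g (Function.update ⊥ k true) - g ⊥) := by
  let value (w : κ → Bool) : ((κ → Bool) → ℝ) →ₗ[ℝ] ℝ := LinearMap.proj w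
  let slope : ((κ → Bool) → ℝ) →ₗ[ℝ] ℝ := ∑ k, (value (Function.update ⊥ k true) - value ⊥)
  suffices h_le : cubeDegreeLE κ d ≤
      LinearMap.eqLocus (leval 0 ∘ₗ derivative ∘ₗ bernoulliMean) slope by
    simpa [slope, value, leval_apply] using h_le hg
  rw [cubeDegreeLE, Submodule.span_le]
  rintro _ ⟨S, -, rfl⟩
  have h_slope : slope (cubeMonomial S) = ∑ k, if S = {k} then 1 else 0 := by
    simp only [slope, value, LinearMap.coe_sum, Finset.sum_apply, LinearMap.sub_apply,
      LinearMap.proj_apply, cubeMonomial_update_bot_sub_cubeMonomial_bot]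
  suffices h_deriv : (derivative (X ^ #S : ℝ[X])).eval 0 = ∑ k, if S = {k} then 1 else 0 by
    simpa only [SetLike.mem_coe, LinearMap.mem_eqLocus, h_slope, LinearMap.comp_apply,
      bernoulliMean_cubeMonomial, leval_apply] using h_deriv
  by_cases hS : #S = 1
  · obtain ⟨j, rfl⟩ := card_eq_one.mp hS
    simp
  · have h_ne (k : κ) : S ≠ {k} := fun h => hS (h ▸ card_singleton k)
    have h_card : #S = 0 ∨ #S - 1 ≠ 0 := by omega
    simpa [h_ne, derivative_X_pow] using h_card

/-- Where `g` attains its maximal absolute value, positively, `bernoulliMean g` falls by at least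
`g ⊥` per coordinate. -/
theorem card_le_of_update_bot_nonpos (hg : g ∈ cubeDegreeLE κ d) (h_pos : 0 < g ⊥)
    (h_max : ∀ w, |g w| ≤ g ⊥) (h_update : ∀ k, g (Function.update ⊥ k true) ≤ 0) :
    Fintype.card κ ≤ 2 * d ^ 2 := by
  have h_markov := neg_le_eval_derivative_left one_pos h_pos
    (natDegree_bernoulliMean_le hg) fun t ht => abs_eval_bernoulliMean_le h_max ht
  have h_slope : (derivative (bernoulliMean g)).eval 0 ≤ -(Fintype.card κ * g ⊥) := calc
    _ = ∑ k, (g (Function.update ⊥ k true) - g ⊥) := eval_zero_derivative_bernoulliMean hg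
    _ ≤ ∑ _k : κ, -g ⊥ := sum_le_sum fun k _ => by linarith [h_update k]
    _ = -(Fintype.card κ * g ⊥) := by simp
  have h_real : (Fintype.card κ : ℝ) * g ⊥ ≤ 2 * d ^ 2 * g ⊥ := by linarith
  exact_mod_cast le_of_mul_le_mul_right h_real h_pos

end BernoulliMean

section BlockSensitivity

open Finset

variable {ι κ : Type*} [DecidableEq ι] {a d : ℕ} {s p : (ι → Bool) → ℝ} {x : ι → Bool}

theorem card_le_of_pairwise_disjoint_flips [Fintype κ] (hs : s ∈ cubeDegreeLE ι d)
    (h_pos : 0 < s x) (h_max : ∀ y, |s y| ≤ s x) {B : κ → Finset ι}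
    (hB : Pairwise (Function.onFun Disjoint B)) (h_flip : ∀ k, s ((B k).piecewise xᶜ x) ≤ 0) :
    Fintype.card κ ≤ 2 * d ^ 2 := by
  classical
  let chosen (w : κ → Bool) : Finset κ := {k | w k = true}
  let flipBlocks (w : κ → Bool) : ι → Bool := ((chosen w).biUnion B).piecewise xᶜ x
  have h_bot : flipBlocks ⊥ = x := by
    have h_chosen : chosen ⊥ = ∅ := by
      ext j
      simp [chosen]
    simp only [flipBlocks]
    rw [h_chosen, biUnion_empty, piecewise_empty]
  have h_update (k : κ) : flipBlocks (Function.update ⊥ k true) = (B k).piecewise xᶜ x := by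
    have h_chosen : chosen (Function.update ⊥ k true) = {k} := by
      ext j
      simp [chosen, Function.update_apply]
    simp only [flipBlocks]
    rw [h_chosen, singleton_biUnion]
  have h_affine (i : ι) : (fun w => bit (flipBlocks w i)) ∈ cubeDegreeLE κ 1 := by
    by_cases hi : ∃ k, i ∈ B k
    · obtain ⟨k, hk⟩ := hi
      have h_mem (w : κ → Bool) : i ∈ (chosen w).biUnion B ↔ w k = true := by
        simp only [chosen, mem_biUnion, mem_filter_univ]
        refine ⟨fun ⟨j, hj, hij⟩ => ?_, fun hw => ⟨k, hw, hk⟩⟩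
        rwa [← hB.eq (not_disjoint_iff.mpr ⟨i, hij, hk⟩)]
      simpa only [flipBlocks, piecewise, h_mem] using
        apply_mem_cubeDegreeLE (fun b => bit (if b = true then xᶜ i else x i)) k
    · have h_const (w : κ → Bool) : flipBlocks w i = x i :=
        piecewise_eq_of_notMem _ _ _ fun h => hi ((mem_biUnion.mp h).imp fun _ hk => hk.2)
      simpa only [h_const] using const_mem_cubeDegreeLE _ _
  refine card_le_of_update_bot_nonpos (comp_mem_cubeDegreeLE hs h_affine) ?_ ?_ fun k => ?_
  · simpa [h_bot] using h_pos
  · simpa [h_bot] using fun w => h_max (flipBlocks w)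
  · simpa [h_update] using h_flip k

theorem exists_pairwiseDisjoint_subset_forall_not_disjoint {𝒮 : Finset (Finset ι)}
    (h𝒮 : ∀ S ∈ 𝒮, S.Nonempty) :
    ∃ F ⊆ 𝒮, (F : Set (Finset ι)).PairwiseDisjoint id ∧
      ∀ S ∈ 𝒮, ¬ Disjoint S (F.biUnion id) := by
  classical
  let disjointSubfamilies : Finset (Finset (Finset ι)) :=
    {F ∈ 𝒮.powerset | (F : Set (Finset ι)).PairwiseDisjoint id}
  obtain ⟨F, hF⟩ := disjointSubfamilies.exists_maximal ⟨∅, by simp [disjointSubfamilies]⟩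
  simp only [disjointSubfamilies, Maximal, mem_filter, mem_powerset] at hF
  obtain ⟨⟨hF𝒮, hF_disjoint⟩, hF_maximal⟩ := hF
  refine ⟨F, hF𝒮, hF_disjoint, fun S hS h_disjoint => ?_⟩
  rw [disjoint_biUnion_right] at h_disjoint
  have h_insert : insert S F ⊆ F :=
    hF_maximal ⟨insert_subset hS hF𝒮, by
      rw [coe_insert]
      exact hF_disjoint.insert fun T hT _ => h_disjoint T hT⟩ (subset_insert S F)
  exact (h𝒮 S hS).ne_empty (disjoint_self.mp (h_disjoint S (h_insert (mem_insert_self S F))))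

theorem exists_card_le_forall_comp_piecewise_mem_cubeDegreeLE (hs : s ∈ cubeDegreeLE ι d)
    (hp : p ∈ cubeDegreeLE ι (a + 1)) (h_pos : 0 < s x) (h_max : ∀ y, |s y| ≤ s x)
    (hps : ∀ y, p y ≠ 0 → s y ≤ 0) :
    ∃ U : Finset ι, #U ≤ 2 * d ^ 2 * (a + 1) ∧
      ∀ y, (fun z => p (U.piecewise y z)) ∈ cubeDegreeLE ι a := by
  obtain ⟨c, hc, rfl⟩ := exists_coeff_of_mem_cubeDegreeLE hp
  obtain ⟨F, hF, hF_disjoint, hF_meets⟩ := exists_pairwiseDisjoint_subset_forall_not_disjoint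
    (𝒮 := {S ∈ c.support | #S = a + 1}) fun S hS =>
      card_pos.mp ((mem_filter.mp hS).2 ▸ a.succ_pos)
  have hF_top (M : F) : M.1 ∈ c.support ∧ #M.1 = a + 1 := mem_filter.mp (hF M.2)
  have h_block (M : F) : ∃ B ⊆ M.1, s (B.piecewise xᶜ x) ≤ 0 := by
    obtain ⟨B, hBM, hB⟩ := exists_flip_ne_zero_of_top_mem_support (hF_top M).1
      (fun S hS => (hF_top M).2 ▸ hc S hS) x
    exact ⟨B, hBM, hps _ hB⟩
  choose B hBM hB using h_block
  have hF_card : #F ≤ 2 * d ^ 2 := by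
    rw [← Fintype.card_coe]
    refine card_le_of_pairwise_disjoint_flips hs h_pos h_max (fun M N hMN => ?_) hB
    exact (hF_disjoint M.2 N.2 (Subtype.coe_ne_coe.mpr hMN)).mono (hBM M) (hBM N)
  refine ⟨F.biUnion id, ?_, comp_piecewise_mem_cubeDegreeLE_of_not_disjoint hc fun S hS hSa =>
    hF_meets S (mem_filter.mpr ⟨hS, hSa⟩)⟩
  exact (card_biUnion_le_card_mul _ _ (a + 1) fun M hM => (hF_top ⟨M, hM⟩).2.le).trans
    (Nat.mul_le_mul_right _ hF_card)

end BlockSensitivity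

section DecisionTrees

variable {n m : ℕ} {f : BoolFn n}

theorem D_le_of_computes {t : DecisionTree n} (ht : t.Computes f) : D f ≤ t.depth :=
  Nat.sInf_le ⟨t, ht, rfl⟩

theorem D_eq_zero_of_const (h : ∀ x y, f x = f y) : D f = 0 :=
  Nat.le_zero.mp (D_le_of_computes (t := .leaf (f ⊥)) fun x => h ⊥ x)

theorem D_le_add_one_of_update (i : Fin n) (h : ∀ b, D (fun x => f (Function.update x i b)) ≤ m) :
    D f ≤ m + 1 := by
  obtain ⟨t₀, ht₀, hD₀⟩ := D_attained fun x => f (Function.update x i false)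
  obtain ⟨t₁, ht₁, hD₁⟩ := D_attained fun x => f (Function.update x i true)
  have h_computes : (DecisionTree.query i t₀ t₁).Computes f := by
    intro x
    cases hx : x i
    · rw [DecisionTree.eval, if_neg (by simp [hx]), ht₀ x, ← hx]
      exact congrArg f (Function.update_eq_self i x)
    · rw [DecisionTree.eval, if_pos hx, ht₁ x, ← hx]
      exact congrArg f (Function.update_eq_self i x)
  calc D f ≤ 1 + max t₀.depth t₁.depth := D_le_of_computes h_computes
    _ ≤ 1 + m := Nat.add_le_add_left (max_le (hD₀ ▸ h false) (hD₁ ▸ h true)) 1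
    _ = m + 1 := add_comm 1 m

theorem D_le_card_add (U : Finset (Fin n)) (h : ∀ y, D (fun x => f (U.piecewise y x)) ≤ m) :
    D f ≤ U.card + m := by
  induction U using Finset.induction_on generalizing f with
  | empty => simpa using h ⊥
  | insert i U hi ih =>
    rw [Finset.card_insert_of_notMem hi, add_right_comm]
    refine D_le_add_one_of_update i fun b => ih fun y => ?_
    have h_fix (x : Fin n → Bool) : (insert i U).piecewise (Function.update y i b) x =
        Function.update (U.piecewise y x) i b := by
      rw [Finset.piecewise_insert, Function.update_self]
      congr 1
      refine Finset.piecewise_congr _ (fun j hj => ?_) fun _ _ => rfl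
      exact Function.update_of_ne (ne_of_mem_of_not_mem hj hi) _ _
    simpa only [h_fix] using h (Function.update y i b)

/-- `s` represents `f` by its signs: the counterpart of `IsSignRep` for functions on the cube, where
no multilinearity condition is needed. -/
def IsSignFn (f : BoolFn n) (s : (Fin n → Bool) → ℝ) : Prop :=
  ∀ x, s x ≠ 0 ∧ (s x < 0 ↔ f x = true)

/-- `p` represents `f` nondeterministically: it is nonzero exactly where `f` is true. A
representation of the negation of `f` is one of `fᶜ`. -/
def IsNondetRep (f : BoolFn n) (p : (Fin n → Bool) → ℝ) : Prop :=
  ∀ x, p x ≠ 0 ↔ f x = true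

theorem IsNondetRep.apply_eq_apply {p : (Fin n → Bool) → ℝ} (hpf : IsNondetRep f p)
    (hp : p ∈ cubeDegreeLE (Fin n) 0) (x y : Fin n → Bool) : f x = f y := by
  rw [Bool.eq_iff_iff, ← hpf x, ← hpf y, apply_eq_apply_of_mem_cubeDegreeLE_zero hp x y]

theorem D_le_add_of_forall_comp_piecewise_mem {a d : ℕ} {s p : (Fin n → Bool) → ℝ}
    {x : Fin n → Bool} (hs : s ∈ cubeDegreeLE (Fin n) d) (hp : p ∈ cubeDegreeLE (Fin n) (a + 1))
    (h_pos : 0 < s x) (h_max : ∀ y, |s y| ≤ s x) (hps : ∀ y, p y ≠ 0 → s y ≤ 0)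
    (h : ∀ (U : Finset (Fin n)) y, (fun z => p (U.piecewise y z)) ∈ cubeDegreeLE (Fin n) a →
      D (fun z => f (U.piecewise y z)) ≤ m) :
    D f ≤ 2 * d ^ 2 * (a + 1) + m := by
  obtain ⟨U, hU, hUp⟩ :=
    exists_card_le_forall_comp_piecewise_mem_cubeDegreeLE hs hp h_pos h_max hps
  exact (D_le_card_add U fun y => h U y (hUp y)).trans (Nat.add_le_add_right hU m)

theorem D_le_of_isSignFn_of_isNondetRep {d : ℕ} : ∀ {a b : ℕ} {f : BoolFn n}
    {s p q : (Fin n → Bool) → ℝ}, s ∈ cubeDegreeLE (Fin n) d → p ∈ cubeDegreeLE (Fin n) a →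
      q ∈ cubeDegreeLE (Fin n) b → IsSignFn f s → IsNondetRep f p → IsNondetRep fᶜ q →
      D f ≤ 2 * d ^ 2 * (a ^ 2 + b ^ 2)
  | 0, _, _, _, _, _, _, hp, _, _, hpf, _ =>
    (D_eq_zero_of_const (hpf.apply_eq_apply hp)).trans_le (Nat.zero_le _)
  | _ + 1, 0, _, _, _, _, _, _, hq, _, _, hqf =>
    (D_eq_zero_of_const fun x y => Bool.not_inj (hqf.apply_eq_apply hq x y)).trans_le
      (Nat.zero_le _)
  | a + 1, b + 1, f, s, p, q, hs, hp, hq, hsf, hpf, hqf => by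
    obtain ⟨x, hx⟩ := Finite.exists_max fun x => |s x|
    rcases (hsf x).1.lt_or_gt with h_neg | h_pos
    · have h_max (y : Fin n → Bool) : |(-s) y| ≤ (-s) x := by
        simpa [abs_of_neg h_neg] using hx y
      have h_opposite (y : Fin n → Bool) (hy : q y ≠ 0) : (-s) y ≤ 0 := by
        have hfy : f y = false := by simpa using (hqf y).mp hy
        simpa [hfy] using (hsf y).2
      calc D f ≤ 2 * d ^ 2 * (b + 1) + 2 * d ^ 2 * ((a + 1) ^ 2 + b ^ 2) :=
            D_le_add_of_forall_comp_piecewise_mem (Submodule.neg_mem _ hs) hq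
              (neg_pos.mpr h_neg) h_max h_opposite fun U y hUq =>
              D_le_of_isSignFn_of_isNondetRep (comp_piecewise_mem_cubeDegreeLE hs U y)
                (comp_piecewise_mem_cubeDegreeLE hp U y) hUq
                (fun _ => hsf _) (fun _ => hpf _) (fun _ => hqf _)
        _ ≤ 2 * d ^ 2 * ((a + 1) ^ 2 + (b + 1) ^ 2) := by linarith [Nat.zero_le (d ^ 2 * b)]
    · have h_max (y : Fin n → Bool) : |s y| ≤ s x := by
        simpa [abs_of_pos h_pos] using hx y
      have h_opposite (y : Fin n → Bool) (hy : p y ≠ 0) : s y ≤ 0 :=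
        ((hsf y).2.mpr ((hpf y).mp hy)).le
      calc D f ≤ 2 * d ^ 2 * (a + 1) + 2 * d ^ 2 * (a ^ 2 + (b + 1) ^ 2) :=
            D_le_add_of_forall_comp_piecewise_mem hs hp h_pos h_max h_opposite fun U y hUp =>
              D_le_of_isSignFn_of_isNondetRep (comp_piecewise_mem_cubeDegreeLE hs U y) hUp
                (comp_piecewise_mem_cubeDegreeLE hq U y)
                (fun _ => hsf _) (fun _ => hpf _) (fun _ => hqf _)
        _ ≤ 2 * d ^ 2 * ((a + 1) ^ 2 + (b + 1) ^ 2) := by linarith [Nat.zero_le (d ^ 2 * a)]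
  termination_by a b => a + b

end DecisionTrees

section PolynomialDegrees

open MvPolynomial

variable {n d : ℕ}

theorem cubeEval_mem_cubeDegreeLE {p : MvPolynomial (Fin n) ℝ} (hp : p.totalDegree ≤ d) :
    cubeEval p ∈ cubeDegreeLE (Fin n) d := by
  have h_expand : cubeEval p =
      ∑ m ∈ p.support, p.coeff m • ∏ i ∈ m.support, fun x => bit (x i) ^ m i := by
    funext x
    simp [cubeEval, eval_eq]
  rw [h_expand]
  refine Submodule.sum_mem _ fun m hm => Submodule.smul_mem _ _ ?_
  refine cubeDegreeLE_mono ((le_totalDegree hm).trans hp) (prod_mem_cubeDegreeLE fun i hi => ?_)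
  exact cubeDegreeLE_mono (Nat.one_le_iff_ne_zero.mpr (Finsupp.mem_support_iff.mp hi))
    (apply_mem_cubeDegreeLE (fun b => bit b ^ m i) i)

theorem totalDegree_multilinearRep_le {g : (Fin n → Bool) → ℝ}
    (hg : g ∈ cubeDegreeLE (Fin n) d) : (multilinearRep g).totalDegree ≤ d := by
  obtain ⟨c, hc, rfl⟩ := exists_coeff_of_mem_cubeDegreeLE hg
  let p : MvPolynomial (Fin n) ℝ := ∑ S ∈ c.support, C (c S) * ∏ i ∈ S, X i
  have hp_multilinear : IsMultilinear p := fun i => by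
    refine (degreeOf_sum_le i _ _).trans (Finset.sup_le fun S _ => ?_)
    refine (degreeOf_C_mul_le _ i _).trans ((degreeOf_prod_le i _ _).trans ?_)
    simp only [degreeOf_X, Finset.sum_ite_eq]
    split_ifs <;> simp
  have hp_eval (x : Fin n → Bool) :
      cubeEval p x = Finsupp.linearCombination ℝ cubeMonomial c x := by
    simp [p, cubeEval, cubeMonomial, Finsupp.linearCombination_apply, Finsupp.sum]
  obtain ⟨h_multilinear, h_eval⟩ :=
    multilinearRep_spec (Finsupp.linearCombination ℝ cubeMonomial c)
  rw [multilinear_ext h_multilinear hp_multilinear fun x => (h_eval x).trans (hp_eval x).symm]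
  refine totalDegree_finsetSum_le fun S hS => (totalDegree_mul _ _).trans ?_
  rw [totalDegree_C, zero_add]
  exact (totalDegree_finsetProd _ _).trans (by simpa using hc S hS)

theorem DecisionTree.eval_mem_cubeDegreeLE (t : DecisionTree n) :
    (fun x => bit (t.eval x)) ∈ cubeDegreeLE (Fin n) t.depth := by
  induction t with
  | leaf b => exact const_mem_cubeDegreeLE (bit b) 0
  | query i t₀ t₁ h₀ h₁ =>
    have h_split : (fun x => bit ((query i t₀ t₁).eval x)) =
        (fun x => bit (!x i)) * (fun x => bit (t₀.eval x)) +
          (fun x => bit (x i)) * fun x => bit (t₁.eval x) := by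
      funext x
      cases hx : x i <;> simp [DecisionTree.eval, hx, bit]
    rw [h_split, DecisionTree.depth]
    exact Submodule.add_mem _
      (cubeDegreeLE_mono (Nat.add_le_add_left (le_max_left _ _) 1)
        (mul_mem_cubeDegreeLE (apply_mem_cubeDegreeLE (fun b => bit (!b)) i) h₀))
      (cubeDegreeLE_mono (Nat.add_le_add_left (le_max_right _ _) 1)
        (mul_mem_cubeDegreeLE (apply_mem_cubeDegreeLE bit i) h₁))

theorem deg_le_D (f : BoolFn n) : deg f ≤ D f := by
  obtain ⟨t, ht, hD⟩ := D_attained f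
  obtain rfl : t.eval = f := funext ht
  exact hD ▸ totalDegree_multilinearRep_le t.eval_mem_cubeDegreeLE

theorem IsSignFn.sdeg_le {f : BoolFn n} {s : (Fin n → Bool) → ℝ} (h : IsSignFn f s)
    (hs : s ∈ cubeDegreeLE (Fin n) d) : sdeg f ≤ d := by
  obtain ⟨h_multilinear, h_eval⟩ := multilinearRep_spec s
  have h_rep : IsSignRep f (multilinearRep s) :=
    ⟨h_multilinear, fun x => by simpa only [h_eval] using h x⟩
  exact le_trans (Nat.sInf_le ⟨_, h_rep, rfl⟩) (totalDegree_multilinearRep_le hs)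

theorem exists_isSignFn_mem_cubeDegreeLE_sdeg (f : BoolFn n) :
    ∃ s ∈ cubeDegreeLE (Fin n) (sdeg f), IsSignFn f s := by
  obtain ⟨s, ⟨-, hs⟩, h_sdeg⟩ := sdeg_attained f
  exact ⟨cubeEval s, cubeEval_mem_cubeDegreeLE h_sdeg.ge, hs⟩

theorem exists_mem_cubeDegreeLE_rdeg (f : BoolFn n) :
    ∃ p ∈ cubeDegreeLE (Fin n) (rdeg f), ∃ q ∈ cubeDegreeLE (Fin n) (rdeg f),
      ∀ x, q x ≠ 0 ∧ p x = bit (f x) * q x := by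
  obtain ⟨p, q, ⟨-, -, h⟩, h_rdeg⟩ := rdeg_attained f
  exact ⟨cubeEval p, cubeEval_mem_cubeDegreeLE (h_rdeg ▸ le_max_left _ _),
    cubeEval q, cubeEval_mem_cubeDegreeLE (h_rdeg ▸ le_max_right _ _),
    fun x => ⟨(h x).1, (div_eq_iff (h x).1).mp (h x).2⟩⟩

theorem sdeg_le_two_mul_rdeg (f : BoolFn n) : sdeg f ≤ 2 * rdeg f := by
  obtain ⟨p, hp, q, hq, hpq⟩ := exists_mem_cubeDegreeLE_rdeg f
  have h_sign : IsSignFn f (q * (q - (2 : ℝ) • p)) := fun x => by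
    obtain ⟨hq₀, hpx⟩ := hpq x
    have h_value : (q * (q - (2 : ℝ) • p)) x = (1 - 2 * bit (f x)) * q x ^ 2 := by
      simp only [Pi.mul_apply, Pi.sub_apply, Pi.smul_apply, smul_eq_mul, hpx]
      ring
    have h_sq : 0 < q x ^ 2 := by positivity
    rw [h_value]
    cases f x <;> norm_num [bit, hq₀, h_sq, h_sq.le]
  rw [two_mul]
  exact h_sign.sdeg_le
    (mul_mem_cubeDegreeLE hq (Submodule.sub_mem _ hq (Submodule.smul_mem _ 2 hp)))

theorem D_le_four_mul_sdeg_sq_mul_rdeg_sq (f : BoolFn n) :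
    D f ≤ 4 * sdeg f ^ 2 * rdeg f ^ 2 := by
  obtain ⟨s, hs, h_sign⟩ := exists_isSignFn_mem_cubeDegreeLE_sdeg f
  obtain ⟨p, hp, q, hq, hpq⟩ := exists_mem_cubeDegreeLE_rdeg f
  have hp_nondet : IsNondetRep f p := fun x => by
    rw [(hpq x).2]
    cases f x <;> simp [bit, (hpq x).1]
  have hq_nondet : IsNondetRep fᶜ (q - p) := fun x => by
    rw [Pi.sub_apply, (hpq x).2, Pi.compl_apply]
    cases f x <;> simp [bit, (hpq x).1]
  calc D f ≤ 2 * sdeg f ^ 2 * (rdeg f ^ 2 + rdeg f ^ 2) :=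
        D_le_of_isSignFn_of_isNondetRep hs hp (Submodule.sub_mem _ hq hp) h_sign hp_nondet
          hq_nondet
    _ = 4 * sdeg f ^ 2 * rdeg f ^ 2 := by ring

end PolynomialDegrees

end BooleanFunction

theorem mainTheorem2 (n : ℕ) (f : BooleanFunction.BoolFn n) :
    BooleanFunction.deg f ≤ BooleanFunction.D f ∧
    BooleanFunction.D f ≤ 4 * BooleanFunction.sdeg f ^ 2 * BooleanFunction.rdeg f ^ 2 ∧
    4 * BooleanFunction.sdeg f ^ 2 * BooleanFunction.rdeg f ^ 2 ≤
      16 * BooleanFunction.rdeg f ^ 4 := by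
  refine ⟨BooleanFunction.deg_le_D f, BooleanFunction.D_le_four_mul_sdeg_sq_mul_rdeg_sq f, ?_⟩
  calc 4 * BooleanFunction.sdeg f ^ 2 * BooleanFunction.rdeg f ^ 2
      ≤ 4 * (2 * BooleanFunction.rdeg f) ^ 2 * BooleanFunction.rdeg f ^ 2 := by
        gcongr
        exact BooleanFunction.sdeg_le_two_mul_rdeg f
    _ = 16 * BooleanFunction.rdeg f ^ 4 := by ring
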